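/- **Setting.** Let $\mathsf V$ be a commutative unital quantale: a complete lattice with a commutative monoid structure $(\otimes,k)$ such that $\otimes$ distributes over arbitrary suprema; its internal hom is given by $u\otimes v\le w\iff v\le\hom(u,w)$. Assume $k\ne\bot$ and that $\mathsf V$ is constructively completely distributive (the supremum map from the down-closed subsets of $\mathsf V$, ordered by inclusion, to $\mathsf V$ has a left adjoint). A $\mathsf V$-matrix from $X$ to $Y$ is a map $r:X\times Y\to\mathsf V$; matrices compose by $(s\cdot r)(x,z)=\bigvee_y r(x,y)\otimes s(y,z)$, $r^\circ$ denotes the transpose, and a map $f:X\to Y$ is the matrix with value $k$ if $f(x)=y$ and $\bot$ otherwise. Let $\mathbb T=(T,e,m)$ be a monad on $\mathbf{Set}$ that is non-trivial (i.e. neither $TX=1$ for all $X$, nor $T\varnothing=\varnothing$ and $TX=1$ for all $X\neq\varnothing$), such that $T$ sends pullbacks to weak pullbacks and every naturality square of $m$ is a weak pullback. $T$ is extended to $\mathsf V$-matrices $a$ from $X$ to $Y$ by $$Ta(\mathfrak x,\mathfrak y)=\bigvee\{v\in\mathsf V\mid \exists\,\mathfrak w\in T(\{(x,y)\mid v\le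 a(x,y)\}):\ T\pi_X(\mathfrak w)=\mathfrak x,\ T\pi_Y(\mathfrak w)=\mathfrak y\},$$ where $\pi_X,\pi_Y$ are the projections, and we assume $k=\top$ or $T\varnothing=\varnothing$ (so that this agrees with the functor $T$ on maps). Let $\xi:T\mathsf V\to\mathsf V$, $\xi(\mathfrak x)=\bigvee\{v\mid\mathfrak x\in T(\uparrow v)\}$, where $\uparrow v=\{u\mid v\le u\}$ and $T(\uparrow v)$ is regarded as a subset of $T\mathsf V$, and assume $\xi(T\pi_1(\mathfrak w))\otimes\xi(T\pi_2(\mathfrak w))=\xi(T(\otimes)(\mathfrak w))$ for all $\mathfrak w\in T(\mathsf V\times\mathsf V)$. **Definitions.** A $(\mathbb T,\mathsf V)$-category is a set $X$ with $a:TX\times X\to\mathsf V$ such that $k\le a(e_X(x),x)$ and $Ta(\mathfrak X,\mathfrak x)\otimes a(\mathfrak x,x)\le a(m_X(\mathfrak X),x)$ for all $x\in X$, $\mathfrak x\in TX$, $\mathfrak X\in TTX$; a $(\mathbb T,\mathsf V)$-functor $f:(X,a)\to(Y,b)$ is a map with $a(\mathfrak x,x)\le b(Tf(\mathfrak x),f(x))$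 for all $\mathfrak x\in TX$, $x\in X$. We use the following $(\mathbb T,\mathsf V)$-structures. * $|X|=(TX,m_X)$ with $m_X$ read as a matrix, and $P=(1,e_1^\circ)$. * $\mathsf V=(\mathsf V,\hom_\xi)$ with $\hom_\xi(\mathfrak v,v)=\hom(\xi(\mathfrak v),v)$. * $(X,a)\otimes(Y,b)=(X\times Y,a\otimes b)$ with $(a\otimes b)(\mathfrak w,(x,y))=a(T\pi_X(\mathfrak w),x)\otimes b(T\pi_Y(\mathfrak w),y)$. * $X^{\mathrm{op}}=(TX,\ e_{TX}^\circ\cdot T((Ta\cdot m_X^\circ)^\circ))$, the dual of $(X,a)$. * $\mathsf V^{|X|}$ has as elements the maps $h:TX\to\mathsf V$ such that $(\mathfrak x,\star)\mapsto h(\mathfrak x)$ is a $(\mathbb T,\mathsf V)$-functor $|X|\otimes P\to\mathsf V$. For $\mathfrak p\in T(\mathsf V^{|X|})$ and $h\in\mathsf V^{|X|}$ its structure is $$[\![m_X,\hom_\xi]\!](\mathfrak p,h)=\bigvee\{v\in\mathsf V\mid\forall\,\mathfrak q\in T(TX\times\mathsf V^{|X|})\text{ with }T\pi_2(\mathfrak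 q)=\mathfrak p,\ \forall\,\mathfrak y\in TX:\ m_X(T\pi_1(\mathfrak q),\mathfrak y)\otimes v\le\hom_\xi(T\mathrm{ev}(\mathfrak q),h(\mathfrak y))\},$$ where $\mathrm{ev}(\mathfrak y,h)=h(\mathfrak y)$. For a $(\mathbb T,\mathsf V)$-category $(X,a)$ let $\mathbf y:X\to\mathsf V^{|X|}$, $\mathbf y(x)=a(-,x)$, be the transpose of $a:|X|\otimes X\to\mathsf V$. **Theorem 4.2 (Yoneda).** Let $(X,a)$ be a $(\mathbb T,\mathsf V)$-category. (a) For all $\mathfrak x\in TX$ and $\varphi\in\mathsf V^{|X|}$, $[\![m_X,\hom_\xi]\!](T\mathbf y(\mathfrak x),\varphi)\le\varphi(\mathfrak x)$. (b) For every $\varphi\in\mathsf V^{|X|}$: $\varphi(\mathfrak x)\le[\![m_X,\hom_\xi]\!](T\mathbf y(\mathfrak x),\varphi)$ holds for all $\mathfrak x\in TX$ if and only if $\varphi:X^{\mathrm{op}}\to\mathsf V$ is a $(\mathbb T,\mathsf V)$-functor. -/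

import Mathlib

universe u

namespace TVCat

open CategoryTheory

/-! ### Set monads, written elementwise -/

section SetMonad

variable (T : Monad (Type u))

/-- `T f : T X → T Y` for a map of sets `f : X → Y`. -/
def tmap {X Y : Type u} (f : X → Y) : T.obj X → T.obj Y := fun x => T.map (↾f) x

/-- The unit `e_X : X → T X`. -/
def unit (X : Type u) : X → T.obj X := fun x => T.η.app X x

/-- The multiplication `m_X : T T X → T X`. -/
def mult (X : Type u) : T.obj (T.obj X) → T.obj X := fun x => T.μ.app X x

theorem tmap_comp {X Y Z : Type u} (g : Y → Z) (f : X → Y) (x : T.obj X) :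
    tmap T g (tmap T f x) = tmap T (g ∘ f) x := by
  have h : T.map (↾(g ∘ f)) = T.map (↾f) ≫ T.map (↾g) := by
    rw [← T.map_comp]; rfl
  simp only [tmap, h]
  rfl

theorem tmap_unit {X Y : Type u} (f : X → Y) (x : X) :
    tmap T f (unit T X x) = unit T Y (f x) := by
  have h := ConcreteCategory.congr_hom (T.η.naturality (↾f)) x
  exact h.symm

/-- There are two trivial monads: the one with `T X = 1` for all `X`, and the one with `T ∅ = ∅`
and `T X = 1` for `X ≠ ∅`. -/
def IsTrivialMonad : Prop :=
  (∀ X : Type u, Nonempty (Unique (T.obj X))) ∨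
    (IsEmpty (T.obj PEmpty.{u + 1}) ∧
      ∀ X : Type u, Nonempty X → Nonempty (Unique (T.obj X)))

/-- The commutative square `f ∘ p = g ∘ q` of sets is a pullback. -/
def IsPullbackSquare {P X Y Z : Type u} (p : P → X) (q : P → Y) (f : X → Z) (g : Y → Z) : Prop :=
  (∀ w, f (p w) = g (q w)) ∧ ∀ x y, f x = g y → ∃! w, p w = x ∧ q w = y

/-- The commutative square `f ∘ p = g ∘ q` of sets is a weak pullback. -/
def IsWeakPullbackSquare {P X Y Z : Type u} (p : P → X) (q : P → Y) (f : X → Z) (g : Y → Z) :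
    Prop :=
  (∀ w, f (p w) = g (q w)) ∧ ∀ x y, f x = g y → ∃ w, p w = x ∧ q w = y

/-- `T` satisfies (BC): it sends pullbacks to weak pullbacks. -/
def FunctorBC : Prop :=
  ∀ ⦃P X Y Z : Type u⦄ (p : P → X) (q : P → Y) (f : X → Z) (g : Y → Z),
    IsPullbackSquare p q f g →
      IsWeakPullbackSquare (tmap T p) (tmap T q) (tmap T f) (tmap T g)

/-- `m` satisfies (BC): each of its naturality squares is a weak pullback. -/
def MultBC : Prop :=
  ∀ ⦃X Y : Type u⦄ (f : X → Y),
    IsWeakPullbackSquare (mult T X) (tmap T (tmap T f)) (tmap T f) (mult T Y)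

end SetMonad

/-! ### The quantale and matrices over it

A commutative unital quantale is a complete lattice with a commutative monoid structure for which
`*` distributes over arbitrary suprema; `u ⊗ v` is `u * v` and the unit `k` is `1`. -/

section Matrices

variable {V : Type u} [CommMonoid V] [CompleteLattice V]

/-- Constructive complete distributivity: the supremum map from the down-closed subsets of `V`
(ordered by inclusion) to `V` has a left adjoint. -/
def IsCCD (V : Type u) [CompleteLattice V] : Prop :=
  ∃ l : V → LowerSet V, GaloisConnection l (fun D : LowerSet V => sSup (D : Set V))

/-- The internal hom of the quantale, `u ⊗ v ≤ w ↔ v ≤ qhom u w`. -/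
def qhom [IsQuantale V] (u w : V) : V := Quantale.rightMulResiduation u w

theorem le_qhom [IsQuantale V] {u v w : V} : v ≤ qhom u w ↔ u * v ≤ w :=
  Quantale.rightMulResiduation_le_iff_mul_le

/-- The composite `s · r` of `V`-matrices `r : X ⇸ Y` and `s : Y ⇸ Z`. -/
def comp {X Y Z : Type u} (s : Y → Z → V) (r : X → Y → V) : X → Z → V :=
  fun x z => ⨆ y, r x y * s y z

/-- The transpose of a `V`-matrix. -/
def transpose {X Y : Type u} (r : X → Y → V) : Y → X → V := fun y x => r x y

open Classical in
/-- A map of sets as a `V`-matrix. -/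
noncomputable def graph (V : Type u) [CommMonoid V] [CompleteLattice V] {X Y : Type u}
    (f : X → Y) : X → Y → V :=
  fun x y => if f x = y then 1 else ⊥

variable (T : Monad (Type u))

/-- Barr's extension of `T` to relations, `T r = T p · (T q)°` where `q`, `p` are the projections
of (the graph of) `r`. -/
def relExt {X Y : Type u} (r : X → Y → Prop) (x : T.obj X) (y : T.obj Y) : Prop :=
  ∃ w : T.obj {z : X × Y // r z.1 z.2},
    tmap T (fun z => z.1.1) w = x ∧ tmap T (fun z => z.1.2) w = y

/-- The extension of `T` to `V`-matrices, obtained from the extension to relations through the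
relations `a_v = {(x, y) | v ≤ a x y}`. -/
def matExt {X Y : Type u} (a : X → Y → V) (x : T.obj X) (y : T.obj Y) : V :=
  sSup {v : V | relExt T (fun x' y' => v ≤ a x' y') x y}

/-- The algebra structure `ξ : T V → V`, `ξ x = ⋁ {v | x ∈ T (↑ v)}`, where `T (↑ v)` is
regarded as a subset of `T V` along the image of the inclusion. -/
def xi (x : T.obj V) : V :=
  sSup {v : V | x ∈ Set.range (tmap T (Subtype.val : {w : V // v ≤ w} → V))}

/-- Compatibility of `ξ` with the tensor product of `V`:
`⊗ · ⟨ξ · T π₁, ξ · T π₂⟩ = ξ · T ⊗`. -/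
def XiPreservesTensor (V : Type u) [CommMonoid V] [CompleteLattice V]
    (T : Monad (Type u)) : Prop :=
  ∀ w : T.obj (V × V),
    xi T (tmap T Prod.fst w) * xi T (tmap T Prod.snd w) =
      xi T (tmap T (fun p : V × V => p.1 * p.2) w)

/-! ### `(T, V)`-categories -/

/-- `(X, a)` is a `(T, V)`-category. -/
structure IsTVCategory {X : Type u} (a : T.obj X → X → V) : Prop where
  refl : ∀ x : X, 1 ≤ a (unit T X x) x
  trans : ∀ (xx : T.obj (T.obj X)) (y : T.obj X) (x : X),
    matExt T a xx y * a y x ≤ a (mult T X xx) x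

/-- `f : (X, a) → (Y, b)` is a `(T, V)`-functor. -/
def IsTVFunctor {X Y : Type u} (a : T.obj X → X → V) (b : T.obj Y → Y → V) (f : X → Y) : Prop :=
  ∀ (y : T.obj X) (x : X), a y x ≤ b (tmap T f y) (f x)

/-- The structure `m_X` (as a `V`-matrix) of the `(T, V)`-category `|X| = (T X, m_X)`. -/
noncomputable def freeStr (V : Type u) [CommMonoid V] [CompleteLattice V] (T : Monad (Type u))
    (X : Type u) : T.obj (T.obj X) → T.obj X → V :=
  graph V (mult T X)

/-- The structure `a ⊗ b` on `X × Y`. -/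
def tensorStr {X Y : Type u} (a : T.obj X → X → V) (b : T.obj Y → Y → V) :
    T.obj (X × Y) → X × Y → V :=
  fun w z => a (tmap T Prod.fst w) z.1 * b (tmap T Prod.snd w) z.2

/-- The structure `p = e_1°` of the `(T, V)`-category `P = (1, p)`. -/
noncomputable def pointStr (V : Type u) [CommMonoid V] [CompleteLattice V] (T : Monad (Type u)) :
    T.obj PUnit.{u + 1} → PUnit.{u + 1} → V :=
  transpose (graph V (unit T PUnit.{u + 1}))

/-- The canonical structure `hom_ξ = hom · ξ` on `V`. -/
def homXi (V : Type u) [CommMonoid V] [CompleteLattice V] [IsQuantale V] (T : Monad (Type u)) :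
    T.obj V → V → V :=
  fun x v => qhom (xi T x) v

/-- The `V`-category structure of `M°(X, a) = (T X, T a · m_X°)`. -/
noncomputable def mStr {X : Type u} (a : T.obj X → X → V) : T.obj X → T.obj X → V :=
  comp (matExt T a) (transpose (graph V (mult T X)))

/-- The `(T, V)`-category structure of `E°(Y, b) = (Y, e_Y° · T b)`, for a `V`-category `(Y, b)`. -/
noncomputable def eStr {Y : Type u} (b : Y → Y → V) : T.obj Y → Y → V :=
  comp (transpose (graph V (unit T Y))) (matExt T b)

/-- The structure of the dual `(T, V)`-category `X^op = E°(M°(X)^op)`, whose underlying set is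
`T X`. -/
noncomputable def opStr {X : Type u} (a : T.obj X → X → V) : T.obj (T.obj X) → T.obj X → V :=
  eStr T (transpose (mStr T a))

/-! ### Function spaces and the transpose `y : X → V^|X|` -/

/-- The underlying set of `Y^X`: the maps `h : X → Y` which are `(T, V)`-functors
`X ⊗ P → Y`. -/
def FunSpace {X Y : Type u} (a : T.obj X → X → V) (b : T.obj Y → Y → V) : Type u :=
  {h : X → Y // IsTVFunctor T (tensorStr T a (pointStr V T)) b
    (fun z : X × PUnit.{u + 1} => h z.1)}

/-- The evaluation map `X × Y^X → Y`. -/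
def evalMap {X Y : Type u} (a : T.obj X → X → V) (b : T.obj Y → Y → V) :
    X × FunSpace T a b → Y :=
  fun z => z.2.1 z.1

/-- The structure `⟦a, b⟧` of the function space `Y^X`. -/
def funSpaceStr {X Y : Type u} (a : T.obj X → X → V) (b : T.obj Y → Y → V) :
    T.obj (FunSpace T a b) → FunSpace T a b → V :=
  fun p h => sSup {v : V | ∀ q : T.obj (X × FunSpace T a b), tmap T Prod.snd q = p →
    ∀ x : X, a (tmap T Prod.fst q) x * v ≤ b (tmap T (evalMap T a b) q) (h.1 x)}

/-- For every point `x` of a `(T, V)`-category `(X, a)`, the map `a(-, x) : T X → V` is an element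
of `V^|X|`. -/
theorem isTVFunctor_row [IsQuantale V] (hT : FunctorBC T) {X : Type u} {a : T.obj X → X → V}
    (ha : IsTVCategory T a) (x : X) :
    IsTVFunctor T (tensorStr T (freeStr V T X) (pointStr V T)) (homXi V T)
      (fun z : T.obj X × PUnit.{u + 1} => a z.1 x) := by
  intro W z
  unfold tensorStr freeStr pointStr transpose graph homXi
  rw [le_qhom]
  by_cases h1 : mult T X (tmap T Prod.fst W) = z.1
  swap
  · simp [h1]
  by_cases h2 : unit T PUnit.{u + 1} z.2 = tmap T Prod.snd W
  swap
  · simp [h2]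
  rw [if_pos h1, if_pos h2, mul_one, mul_one]
  change _ ≤ a z.1 x
  rw [← h1]
  refine sSup_le ?_
  rintro v ⟨s, hs⟩
  -- the part of `T X × 1` on which `a(-, x)` is at least `v`
  let S := {z : T.obj X × PUnit.{u + 1} // v ≤ a z.1 x}
  have hpb : IsPullbackSquare (Subtype.val : S → _)
      (fun z : S => (⟨a z.1.1 x, z.2⟩ : {w : V // v ≤ w}))
      (fun z : T.obj X × PUnit.{u + 1} => a z.1 x) Subtype.val := by
    refine ⟨fun _ => rfl, fun y w hy => ⟨⟨y, le_of_le_of_eq w.2 hy.symm⟩, ⟨rfl, Subtype.ext hy⟩, ?_⟩⟩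
    rintro t ⟨ht, -⟩
    exact Subtype.ext ht
  obtain ⟨t, ht, -⟩ := (hT _ _ _ _ hpb).2 W s hs.symm
  have hmem : v ≤ matExt T a (tmap T Prod.fst W) (unit T X x) := by
    refine le_sSup ⟨tmap T (fun z : S => ⟨(z.1.1, x), z.2⟩) t, ?_, ?_⟩
    · rw [tmap_comp, ← ht, tmap_comp]; rfl
    · rw [tmap_comp]
      have : tmap T (fun _ : PUnit.{u + 1} => x) (tmap T Prod.snd W) = unit T X x := by
        rw [← h2, tmap_unit]
      rw [← this, ← ht, tmap_comp, tmap_comp]; rfl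
  calc v = v * 1 := (mul_one v).symm
    _ ≤ matExt T a (tmap T Prod.fst W) (unit T X x) * a (unit T X x) x :=
        mul_le_mul' hmem (ha.refl x)
    _ ≤ _ := ha.trans _ _ _

/-- The transpose `y : X → V^|X|` of `a : |X| ⊗ X → V`, that is, `y(x) = a(-, x)`. -/
def yoneda [IsQuantale V] (hT : FunctorBC T) {X : Type u} {a : T.obj X → X → V}
    (ha : IsTVCategory T a) : X → FunSpace T (freeStr V T X) (homXi V T) :=
  fun x => ⟨fun y => a y x, isTVFunctor_row T hT ha x⟩

end Matrices

end TVCat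

namespace TVCat

open CategoryTheory

/-! ### Units, inverse images and degenerate monads. -/

section MonadLemmas

variable {T : Monad (Type u)}

/-! By (BC), `matExt T a x y` is the supremum of `ξ(T a(w))` over all `w` projecting to `x` and `y`
(`xi_le_matExt`, `matExt_le`). Since evaluation after `1 × y` is `a`, and `T` lifts along the
pullback of `y`, a value `v` lies below the function space structure at `(T y(x), φ)` iff `Ta(𝔛, x)
⊗ v ≤ φ(m 𝔛)` for all `𝔛` (`le_funSpaceStr_yoneda_iff`). Taking `𝔛 = T e(x)` and using reflexivity
of `a` gives (a). Taking `v = φ(x)` for all `x` says that `φ` is a `V`-functor on the dual of `(TX,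
Ta · m°)`, and `isTVFunctor_eStr_iff` identifies these with the `(T, V)`-functors on the dual of
`X`, which is (b). -/

theorem tmap_id {X : Type u} (x : T.obj X) : tmap T id x = x := by
  have h : T.map (↾(id : X → X)) = 𝟙 _ := T.map_id X
  simp only [tmap, h]
  rfl

theorem mult_unit {X : Type u} (x : T.obj X) : mult T X (unit T (T.obj X) x) = x :=
  ConcreteCategory.congr_hom (T.left_unit X) x

theorem mult_tmap_unit {X : Type u} (x : T.obj X) : mult T X (tmap T (unit T X) x) = x :=
  ConcreteCategory.congr_hom (T.right_unit X) x

/-- A functor with (BC) preserves inverse images of subsets. -/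
theorem FunctorBC.exists_lift (hT : FunctorBC T) {X Y : Type u} (f : X → Y) (S : Y → Prop)
    {w : T.obj X} (hw : tmap T f w ∈ Set.range (tmap T (Subtype.val : {y // S y} → Y))) :
    ∃ t : T.obj {x // S (f x)}, tmap T Subtype.val t = w := by
  obtain ⟨s, hs⟩ := hw
  have hpb : IsPullbackSquare (Subtype.val : {x // S (f x)} → X)
      (fun x => (⟨f x.1, x.2⟩ : {y // S y})) f Subtype.val := by
    refine ⟨fun _ => rfl, fun x y h => ⟨⟨x, h ▸ y.2⟩, ⟨rfl, Subtype.ext h⟩, ?_⟩⟩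
    rintro t ⟨ht, -⟩
    exact Subtype.ext ht
  obtain ⟨t, ht, -⟩ := (hT _ _ _ _ hpb).2 w s hs.symm
  exact ⟨t, ht⟩

/-- If the unit identifies a point with an element coming from `T ∅`, then `T` is trivial. -/
theorem isTrivialMonad_of_tmap_eq_unit {E Y : Type u} [IsEmpty E] (f : E → Y)
    (t : T.obj E) (y : Y) (h : tmap T f t = unit T Y y) : IsTrivialMonad T := by
  have hpoint : unit T PUnit.{u + 1} ⟨⟩ = tmap T (fun _ => ⟨⟩) t := by
    rw [← tmap_unit T (fun _ : Y => (⟨⟩ : PUnit.{u + 1})) y, ← h, tmap_comp]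
  -- Every point is an image of the point of `1`, so all units factor through `t` and are constant;
  -- `m · e = 1` then collapses `T Z`.
  have hunit : ∀ (Z : Type u) (z : Z), unit T Z z = tmap T isEmptyElim t := by
    intro Z z
    rw [← tmap_unit T (fun _ : PUnit.{u + 1} => z) ⟨⟩, hpoint, tmap_comp]
    congr 1
    exact Subsingleton.elim _ _
  refine Or.inl fun Z => ⟨⟨⟨tmap T isEmptyElim t⟩, fun z => ?_⟩⟩
  rw [← mult_unit z, hunit, ← hunit (T.obj Z) (tmap T isEmptyElim t), mult_unit]
  rfl

/-- For a nontrivial monad, `e_Y(y) ∈ T S` only if `y ∈ S`. -/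
theorem FunctorBC.of_unit_mem_range (hT : FunctorBC T) (hnt : ¬ IsTrivialMonad T) {Y : Type u}
    (S : Y → Prop) (y : Y)
    (h : unit T Y y ∈ Set.range (tmap T (Subtype.val : {y // S y} → Y))) : S y := by
  by_contra hy
  -- With `y` read as a map from `1`, the inverse image of `S` is empty when `y ∉ S`.
  rw [← tmap_unit T (fun _ : PUnit.{u + 1} => y) ⟨⟩] at h
  obtain ⟨t, ht⟩ := hT.exists_lift _ S h
  have : IsEmpty {x : PUnit.{u + 1} // S y} := ⟨fun x => hy x.2⟩
  exact hnt (isTrivialMonad_of_tmap_eq_unit _ t _ ht)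

end MonadLemmas

/-! ### The map `ξ`, the matrix extension and the function space structure. -/

section MatrixLemmas

variable {V : Type u} [CompleteLattice V] {T : Monad (Type u)}

theorem le_xi_tmap {Z : Type u} (f : Z → V) (v : V) (t : T.obj {z // v ≤ f z}) :
    v ≤ xi T (tmap T f (tmap T Subtype.val t)) := by
  refine le_sSup ⟨tmap T (fun z : {z // v ≤ f z} => (⟨f z.1, z.2⟩ : {w : V // v ≤ w})) t, ?_⟩
  rw [tmap_comp, tmap_comp]
  rfl

theorem xi_tmap_mono (hT : FunctorBC T) {Z : Type u} {f g : Z → V} (h : ∀ z, f z ≤ g z)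
    (w : T.obj Z) : xi T (tmap T f w) ≤ xi T (tmap T g w) := by
  refine sSup_le fun v hv => ?_
  obtain ⟨t, rfl⟩ := hT.exists_lift f (fun u => v ≤ u) hv
  have := le_xi_tmap g v (tmap T (fun z : {z // v ≤ f z} => ⟨z.1, z.2.trans (h z.1)⟩) t)
  rwa [tmap_comp T Subtype.val] at this

theorem le_xi_unit (v : V) : v ≤ xi T (unit T V v) :=
  le_sSup ⟨unit T _ ⟨v, le_rfl⟩, tmap_unit T _ _⟩

theorem xi_unit (hT : FunctorBC T) (hnt : ¬ IsTrivialMonad T) (v : V) :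
    xi T (unit T V v) = v :=
  le_antisymm (sSup_le fun u hu => hT.of_unit_mem_range hnt (fun w => u ≤ w) v hu) (le_xi_unit v)

theorem le_xi_tmap_of_forall_le {Z : Type u} {f : Z → V} {v : V} (h : ∀ z, v ≤ f z)
    (w : T.obj Z) : v ≤ xi T (tmap T f w) := by
  have := le_xi_tmap f v (tmap T (fun z => ⟨z, h z⟩) w)
  rwa [tmap_comp T Subtype.val, show Subtype.val ∘ (fun z => (⟨z, h z⟩ : {z // v ≤ f z})) = id
    from rfl, tmap_id] at this

/-- If `T a(w)` lies in `T(↑v)`, then (BC) moves `w` into `T` of the relation `v ≤ a`. -/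
theorem xi_le_matExt (hT : FunctorBC T) {X Y : Type u} (a : X → Y → V) (w : T.obj (X × Y)) :
    xi T (tmap T (fun z => a z.1 z.2) w) ≤ matExt T a (tmap T Prod.fst w) (tmap T Prod.snd w) := by
  refine sSup_le fun v hv => le_sSup ?_
  obtain ⟨t, rfl⟩ := hT.exists_lift (fun z : X × Y => a z.1 z.2) (fun u => v ≤ u) hv
  exact ⟨t, (tmap_comp T _ _ _).symm, (tmap_comp T _ _ _).symm⟩

theorem matExt_le {X Y : Type u} {a : X → Y → V} {x : T.obj X} {y : T.obj Y} {c : V}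
    (h : ∀ w : T.obj (X × Y), tmap T Prod.fst w = x → tmap T Prod.snd w = y →
      xi T (tmap T (fun z => a z.1 z.2) w) ≤ c) : matExt T a x y ≤ c := by
  refine sSup_le ?_
  rintro v ⟨t, h₁, h₂⟩
  refine (le_xi_tmap (fun z : X × Y => a z.1 z.2) v t).trans (h _ ?_ ?_)
  · rw [tmap_comp]; exact h₁
  · rw [tmap_comp]; exact h₂

theorem le_matExt_unit (hT : FunctorBC T) {X Y : Type u} (a : X → Y → V) (x : X) (y : Y) :
    a x y ≤ matExt T a (unit T X x) (unit T Y y) := by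
  have h := xi_le_matExt hT a (unit T _ (x, y))
  simp only [tmap_unit] at h
  exact (le_xi_unit _).trans h

variable [CommMonoid V]

theorem one_le_matExt_tmap_unit (hT : FunctorBC T) {X : Type u} {a : T.obj X → X → V}
    (ha : IsTVCategory T a) (x : T.obj X) : 1 ≤ matExt T a (tmap T (unit T X) x) x := by
  -- The witness is the image of `x` under `T⟨e, 1⟩`, along which `a` is everywhere at least `1`.
  have h := xi_le_matExt hT a (tmap T (fun x => (unit T X x, x)) x)
  simp only [tmap_comp] at h
  rw [show Prod.snd ∘ (fun x : X => (unit T X x, x)) = id from rfl, tmap_id] at h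
  exact (le_xi_tmap_of_forall_le ha.refl x).trans h

variable [IsQuantale V]

theorem mStr_mul_le_iff {X : Type u} (a : T.obj X → X → V) (x y : T.obj X) (u c : V) :
    mStr T a y x * u ≤ c ↔ ∀ xx, mult T X xx = y → matExt T a xx x * u ≤ c := by
  rw [mul_comm, ← le_qhom, mStr, comp, iSup_le_iff]
  refine forall_congr' fun xx => ?_
  rw [le_qhom, mul_comm u]
  by_cases h : mult T X xx = y
  · simp [transpose, graph, h]
  · simp [transpose, graph, h]

theorem eStr_eq {Y : Type u} (b : Y → Y → V) (yy : T.obj Y) (y : Y) :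
    eStr T b yy y = matExt T b yy (unit T Y y) := by
  refine le_antisymm (iSup_le fun z => ?_) ?_
  · by_cases h : unit T Y y = z
    · simp [transpose, graph, h]
    · simp [transpose, graph, h]
  · refine le_iSup_of_le (unit T Y y) ?_
    simp [transpose, graph]

theorem forall_graph_mul_le_iff {X Y : Type u} (f : X → Y) (x : X) (u : V) (c : Y → V) :
    (∀ y, graph V f x y * u ≤ c y) ↔ u ≤ c (f x) := by
  refine ⟨fun h => by simpa [graph] using h (f x), fun h y => ?_⟩
  by_cases hy : f x = y
  · subst hy
    simpa [graph] using h
  · simp [graph, hy]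

/-- Residuation makes the defining condition closed under suprema, so the supremum satisfies it too;
as `m` is a map, only its value has to be tested. -/
theorem le_funSpaceStr_freeStr_iff {X : Type u} (p : T.obj (FunSpace T (freeStr V T X) (homXi V T)))
    (φ : FunSpace T (freeStr V T X) (homXi V T)) (v : V) :
    v ≤ funSpaceStr T (freeStr V T X) (homXi V T) p φ ↔
      ∀ q : T.obj (T.obj X × FunSpace T (freeStr V T X) (homXi V T)), tmap T Prod.snd q = p →
        xi T (tmap T (evalMap T (freeStr V T X) (homXi V T)) q) * v ≤
          φ.1 (mult T X (tmap T Prod.fst q)) := by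
  have key : ∀ u : V, (∀ q : T.obj (T.obj X × FunSpace T (freeStr V T X) (homXi V T)),
      tmap T Prod.snd q = p → ∀ y, freeStr V T X (tmap T Prod.fst q) y * u ≤
        homXi V T (tmap T (evalMap T (freeStr V T X) (homXi V T)) q) (φ.1 y)) ↔
      ∀ q : T.obj (T.obj X × FunSpace T (freeStr V T X) (homXi V T)), tmap T Prod.snd q = p →
        xi T (tmap T (evalMap T (freeStr V T X) (homXi V T)) q) * u ≤
          φ.1 (mult T X (tmap T Prod.fst q)) := by
    refine fun u => forall_congr' fun q => forall_congr' fun _ => ?_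
    rw [← le_qhom]
    exact forall_graph_mul_le_iff (mult T X) _ u fun y => homXi V T _ (φ.1 y)
  refine ⟨fun h q hq => ?_, fun h => le_sSup ((key v).2 h)⟩
  rw [← le_qhom]
  refine h.trans (sSup_le fun u hu => ?_)
  rw [le_qhom]
  exact (key u).1 hu q hq

/-- The structure of `V^|X|` at the image of `y : X → V^|X|`. -/
theorem le_funSpaceStr_yoneda_iff (hT : FunctorBC T) {X : Type u} {a : T.obj X → X → V}
    (ha : IsTVCategory T a) (x : T.obj X) (φ : FunSpace T (freeStr V T X) (homXi V T)) (v : V) :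
    v ≤ funSpaceStr T (freeStr V T X) (homXi V T) (tmap T (yoneda T hT ha) x) φ ↔
      ∀ xx : T.obj (T.obj X), matExt T a xx x * v ≤ φ.1 (mult T X xx) := by
  rw [le_funSpaceStr_freeStr_iff]
  constructor
  · intro h xx
    rw [mul_comm, ← le_qhom]
    refine matExt_le fun w h₁ h₂ => ?_
    have hw := h (tmap T (fun z => (z.1, yoneda T hT ha z.2)) w)
      (by rw [tmap_comp, ← h₂, tmap_comp]; rfl)
    rw [tmap_comp, tmap_comp] at hw
    rw [le_qhom, mul_comm, ← h₁]
    exact hw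
  · intro h q hq
    -- `TX × X` is the pullback of the second projection along `y`, so each `q` over `T y(x)` is
    -- `T(1 × y)(w)` for some `w` over `x`.
    have hpb : IsPullbackSquare (fun z : T.obj X × X => (z.1, yoneda T hT ha z.2)) Prod.snd
        Prod.snd (yoneda T hT ha) := by
      refine ⟨fun _ => rfl, ?_⟩
      rintro ⟨y, ψ⟩ x rfl
      refine ⟨(y, x), ⟨rfl, rfl⟩, ?_⟩
      rintro ⟨y', x'⟩ ⟨h₁, h₂⟩
      exact Prod.ext (congrArg Prod.fst h₁ :) h₂
    obtain ⟨w, rfl, rfl⟩ := (hT _ _ _ _ hpb).2 q x hq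
    have hw := (mul_le_mul_left (xi_le_matExt hT a w) v).trans (h (tmap T Prod.fst w))
    rw [tmap_comp, tmap_comp]
    exact hw

/-- `φ` is a `V`-functor on `M°(X)^op` if and only if it is a `(T, V)`-functor on
`X^op = E°(M°(X)^op)`. -/
theorem isTVFunctor_eStr_iff (hT : FunctorBC T) (hnt : ¬ IsTrivialMonad T)
    (htensor : XiPreservesTensor V T) {Y : Type u} (b : Y → Y → V) (φ : Y → V) :
    IsTVFunctor T (eStr T b) (homXi V T) φ ↔ ∀ x y, φ x * b x y ≤ φ y := by
  simp only [IsTVFunctor, eStr_eq, homXi, le_qhom]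
  constructor
  -- Test functoriality at the unit of `x`.
  · intro h x y
    refine le_trans (mul_le_mul' ?_ (le_matExt_unit hT b x y)) (h (unit T Y x) y)
    rw [tmap_unit]
    exact le_xi_unit _
  · intro h yy y
    rw [← le_qhom]
    refine matExt_le fun w h₁ h₂ => ?_
    -- Tensor compatibility turns the product of two values of `ξ` into `ξ` of the pointwise
    -- product, which is dominated by `φ · π₂`. As `w` lies over the unit of `y`, nontriviality then
    -- yields exactly `φ y`.
    have ht := htensor (tmap T (fun z : Y × Y => (φ z.1, b z.1 z.2)) w)
    simp only [tmap_comp] at ht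
    rw [le_qhom, ← h₁, tmap_comp]
    refine ht.le.trans ((xi_tmap_mono hT (g := φ ∘ Prod.snd) (fun z => h z.1 z.2) w).trans ?_)
    rw [← tmap_comp, h₂, tmap_unit, xi_unit hT hnt]

end MatrixLemmas

end TVCat

theorem theorem4p2 {V : Type u} [CommMonoid V] [CompleteLattice V] [IsQuantale V]
    (hV : (1 : V) ≠ ⊥) (hccd : TVCat.IsCCD V)
    (T : CategoryTheory.Monad (Type u)) (hnt : ¬ TVCat.IsTrivialMonad T)
    (hTBC : TVCat.FunctorBC T) (hmBC : TVCat.MultBC T)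
    (hext : (1 : V) = ⊤ ∨ IsEmpty (T.obj PEmpty.{u + 1}))
    (htensor : TVCat.XiPreservesTensor V T)
    {X : Type u} (a : T.obj X → X → V) (ha : TVCat.IsTVCategory T a) :
    (∀ (x : T.obj X) (φ : TVCat.FunSpace T (TVCat.freeStr V T X) (TVCat.homXi V T)),
      TVCat.funSpaceStr T (TVCat.freeStr V T X) (TVCat.homXi V T)
        (TVCat.tmap T (TVCat.yoneda T hTBC ha) x) φ ≤ φ.1 x) ∧
    (∀ φ : TVCat.FunSpace T (TVCat.freeStr V T X) (TVCat.homXi V T),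
      (∀ x : T.obj X, φ.1 x ≤
        TVCat.funSpaceStr T (TVCat.freeStr V T X) (TVCat.homXi V T)
          (TVCat.tmap T (TVCat.yoneda T hTBC ha) x) φ) ↔
      TVCat.IsTVFunctor T (TVCat.opStr T a) (TVCat.homXi V T) φ.1) := by
  refine ⟨fun x φ => ?_, fun φ => ?_⟩
  · have h := (TVCat.le_funSpaceStr_yoneda_iff hTBC ha x φ _).1 le_rfl
      (TVCat.tmap T (TVCat.unit T X) x)
    rw [TVCat.mult_tmap_unit] at h
    refine le_trans ?_ h
    conv_lhs => rw [← one_mul (TVCat.funSpaceStr T _ _ _ _)]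
    exact mul_le_mul_left (TVCat.one_le_matExt_tmap_unit hTBC ha x) _
  · rw [TVCat.opStr, TVCat.isTVFunctor_eStr_iff hTBC hnt htensor]
    simp only [TVCat.le_funSpaceStr_yoneda_iff, TVCat.transpose, mul_comm (φ.1 _),
      TVCat.mStr_mul_le_iff]
    -- Letting `y` vary with `xx` in its fibre under `m` amounts to letting `xx` vary freely.
    exact ⟨fun h x y xx hxx => hxx ▸ h x xx, fun h x xx => h x _ xx rfl⟩
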